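/- Let $\mathbb{D}_r=\{z\in\mathbb{C}:|z|<r\}$ and $\mathbb{D}=\mathbb{D}_1$. Let $\psi$ be analytic and univalent in $\mathbb{D}$ with $\psi(0)=1$ and $\operatorname{Re}\psi>0$, and let $\mathcal{S}^*(\psi)$ be the class of analytic functions $h$ in $\mathbb{D}$ with $h(0)=0$, $h'(0)=1$ and $zh'(z)/h(z)\prec\psi(z)$ (that is, $zh'(z)/h(z)=\psi(\omega(z))$ in $\mathbb{D}$ for some analytic $\omega:\mathbb{D}\to\mathbb{D}$ with $\omega(0)=0$). Put $m(r)=\min_{|z|=r}|\psi(z)|$ for $0<r<1$, and let $r_c$ be the radius of convexity of $\mathcal{S}^*(\psi)$, i.e. the largest $r\le 1$ such that every $h\in\mathcal{S}^*(\psi)$ maps $\mathbb{D}_r$ univalently onto a convex domain. Then the equation $$(1-r^2)\,m(r)-2r=0$$ has a unique root $r_\psi$ in $(0,1)$. Put $R=\min\{r_\psi,r_c\}$, and consider the harmonic mappings $f=h+\bar g$ of $\mathbb{D}$ with $h\in\mathcal{S}^*(\psi)$ and $g=\varphi h$, where $\varphi:\mathbb{D}\to\mathbb{D}$ is analytic (so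 $|\varphi|<1$). (a) Every such $f$ is sense-preserving (its Jacobian $J_f=|f_z|^2-|f_{\bar z}|^2$ is positive) and univalent in $\mathbb{D}_R$. (b) If $r_c\ge r_\psi$ and $m(r)=\psi(-r)$ for all $0<r<1$, the result is sharp: for every $\rho$ with $R<\rho\le 1$ there is such an $f$ which is neither sense-preserving nor univalent in $\mathbb{D}_\rho$. -/

import Mathlib

open Set Metric

noncomputable section

/-- The open disk `|z| < r`; the unit disk is `disk 1`. -/
abbrev disk (r : ℝ) : Set ℂ := ball (0 : ℂ) r

/-- A Ma-Minda function: analytic and univalent in the unit disk, with `ψ 0 = 1` and positive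
real part. -/
structure IsMaMinda (ψ : ℂ → ℂ) : Prop where
  analytic : DifferentiableOn ℂ ψ (disk 1)
  univalent : InjOn ψ (disk 1)
  map_zero : ψ 0 = 1
  re_pos : ∀ z ∈ disk 1, 0 < (ψ z).re

/-- The class of analytic self-maps of the open unit disk. -/
structure IsSelfMap (φ : ℂ → ℂ) : Prop where
  analytic : DifferentiableOn ℂ φ (disk 1)
  mapsTo : MapsTo φ (disk 1) (disk 1)

/-- Subordination `F ≺ G` in the unit disk: `F = G ∘ ω` for an analytic self-map `ω` of the unit
disk fixing the origin. -/
def Subordinate (F G : ℂ → ℂ) : Prop :=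
  ∃ ω : ℂ → ℂ, IsSelfMap ω ∧ ω 0 = 0 ∧ ∀ z ∈ disk 1, F z = G (ω z)

/-- The function `z h'(z) / h(z)`, with its removable singularity at the origin filled in
(for `h 0 = 0` and `h' 0 = 1` the limit there is `1`). -/
def starQuotient (h : ℂ → ℂ) (z : ℂ) : ℂ :=
  if z = 0 then 1 else z * deriv h z / h z

/-- The Ma-Minda class `S*(ψ)`: normalized analytic `h` in the unit disk with
`z h' / h ≺ ψ`. -/
structure MaMindaStarlike (ψ h : ℂ → ℂ) : Prop where
  analytic : DifferentiableOn ℂ h (disk 1)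
  map_zero : h 0 = 0
  deriv_zero : deriv h 0 = 1
  ne_zero : ∀ z ∈ disk 1, z ≠ 0 → h z ≠ 0
  subordinate : Subordinate (starQuotient h) ψ

/-- `m(r)`, the minimum of `|ψ z|` over the circle `|z| = r`
(an attained minimum, see `isLeast_minModulus`). -/
def minModulus (ψ : ℂ → ℂ) (r : ℝ) : ℝ :=
  sInf ((fun z => ‖ψ z‖) '' sphere (0 : ℂ) r)

theorem isLeast_minModulus {ψ : ℂ → ℂ} (hψ : IsMaMinda ψ) {r : ℝ} (h0 : 0 ≤ r) (h1 : r < 1) :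
    IsLeast ((fun z => ‖ψ z‖) '' sphere (0 : ℂ) r) (minModulus ψ r) := by
  have hc : ContinuousOn (fun z => ‖ψ z‖) (sphere (0 : ℂ) r) :=
    (hψ.analytic.continuousOn.mono
      (sphere_subset_closedBall.trans (closedBall_subset_ball h1))).norm
  exact ((isCompact_sphere (0 : ℂ) r).image_of_continuousOn hc).isLeast_sInf
    ((NormedSpace.sphere_nonempty.mpr h0).image _)

/-- `h` maps `U` one-to-one onto a convex set. -/
def ConvexUnivalentOn (h : ℂ → ℂ) (U : Set ℂ) : Prop :=
  InjOn h U ∧ Convex ℝ (h '' U)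

/-- The radius of convexity of `S*(ψ)`: the largest `r ≤ 1` such that every `h` in the class is
convex univalent in `|z| < r`. -/
def radiusOfConvexity (ψ : ℂ → ℂ) : ℝ :=
  sSup {r : ℝ | 0 < r ∧ r ≤ 1 ∧ ∀ h, MaMindaStarlike ψ h → ConvexUnivalentOn h (disk r)}

/-- The Wirtinger derivative `f_z = (f_x - i f_y) / 2`. -/
def wirtinger (f : ℂ → ℂ) (z : ℂ) : ℂ :=
  (fderiv ℝ f z 1 - Complex.I * fderiv ℝ f z Complex.I) / 2

/-- The Wirtinger derivative of `f` in the conjugate variable, `(f_x + i f_y) / 2`. -/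
def wirtingerBar (f : ℂ → ℂ) (z : ℂ) : ℂ :=
  (fderiv ℝ f z 1 + Complex.I * fderiv ℝ f z Complex.I) / 2

/-- The Jacobian of `f` as a map of the plane. -/
def jacobian (f : ℂ → ℂ) (z : ℂ) : ℝ :=
  ‖wirtinger f z‖ ^ 2 - ‖wirtingerBar f z‖ ^ 2

/-- A harmonic mapping is sense-preserving in `U` when its Jacobian is positive there. -/
def SensePreservingOn (f : ℂ → ℂ) (U : Set ℂ) : Prop :=
  ∀ z ∈ U, 0 < jacobian f z

/-- The harmonic mappings `f = h + conj g` of the unit disk with `h` in `S*(ψ)` and `g = φ h`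
for an analytic self-map `φ` of the unit disk. -/
def HarmonicClass (ψ f : ℂ → ℂ) : Prop :=
  ∃ h g φ : ℂ → ℂ, MaMindaStarlike ψ h ∧ IsSelfMap φ ∧
    (∀ z ∈ disk 1, g z = φ z * h z) ∧
    ∀ z ∈ disk 1, f z = h z + (starRingEnd ℂ) (g z)

/-- `r` is a root in `(0, 1)` of `(1 - r²) m(r) - 2 r = 0`. -/
def IsRadiusRoot (ψ : ℂ → ℂ) (r : ℝ) : Prop :=
  0 < r ∧ r < 1 ∧ (1 - r ^ 2) * minModulus ψ r - 2 * r = 0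

end

/-! Put `x = |z|`. Schwarz's lemma gives `|ω z| ≤ x`, so the minimum principle for the zero-free `ψ`
turns `z h' / h = ψ ∘ ω` into `m(x) |h| ≤ x |h'|`. Schwarz-Pick bounds `|φ'|` by `(1 - |φ|²) / (1 -
x²)`. Together, `|g'| ≤ ((1 - |φ|²) x / ((1 - x²) m(x)) + |φ|) |h'|`. Below the root, `x / ((1 - x²)
m(x)) < 1/2`, so the factor is less than `1 - (1 - |φ|)² / 2`. Hence `|g'| < |h'|`
(`MaMindaStarlike.norm_deriv_mul_lt`). If `h` is also convex univalent, `g ∘ h⁻¹` strictly shrinks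
distances on a convex set, so `h + conj g` is injective (`ConvexUnivalentOn.injOn_add_conj`). For
sharpness take `z h' / h = ψ` and `φ z = (z - a) / (1 - a z)` with `a` near `1`. On the negative
radius `f` is real, and past the root it turns back, which rules out injectivity and makes the
Jacobian negative. -/

noncomputable section

/-! ### Disk automorphisms and the Schwarz-Pick lemma -/

/-- The disk automorphism `w ↦ (w + a) / (1 + conj a * w)`. -/
def diskAut (a w : ℂ) : ℂ := (w + a) / (1 + (starRingEnd ℂ) a * w)

theorem one_add_conj_mul_ne_zero {a w : ℂ} (ha : ‖a‖ < 1) (hw : ‖w‖ < 1) :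
    1 + (starRingEnd ℂ) a * w ≠ 0 := by
  intro h
  have h1 : (starRingEnd ℂ) a * w = -1 := by linear_combination h
  have h2 : ‖a‖ * ‖w‖ = 1 := by
    simpa using congrArg norm h1
  nlinarith [norm_nonneg a, norm_nonneg w]

theorem hasDerivAt_diskAut {a w : ℂ} (ha : ‖a‖ < 1) (hw : ‖w‖ < 1) :
    HasDerivAt (diskAut a) ((1 - ‖a‖ ^ 2 : ℝ) / (1 + (starRingEnd ℂ) a * w) ^ 2) w := by
  have hne := one_add_conj_mul_ne_zero ha hw
  have h1 : HasDerivAt (fun w : ℂ => w + a) 1 w := (hasDerivAt_id w).add_const a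
  have h2 : HasDerivAt (fun w : ℂ => 1 + (starRingEnd ℂ) a * w) ((starRingEnd ℂ) a) w := by
    simpa using ((hasDerivAt_id w).const_mul ((starRingEnd ℂ) a)).const_add 1
  refine (h1.div h2 hne).congr_deriv ?_
  have h3 : ((‖a‖ : ℂ)) ^ 2 = (starRingEnd ℂ) a * a := (Complex.conj_mul' a).symm
  push_cast
  rw [h3]
  ring

theorem diskAut_mapsTo {a : ℂ} (ha : ‖a‖ < 1) : MapsTo (diskAut a) (disk 1) (disk 1) := by
  intro w hw
  rw [mem_ball_zero_iff] at hw ⊢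
  have hne := one_add_conj_mul_ne_zero ha hw
  rw [diskAut, norm_div, div_lt_one (norm_pos_iff.mpr hne)]
  refine lt_of_pow_lt_pow_left₀ 2 (norm_nonneg _) ?_
  have e1 : ‖w + a‖ ^ 2 = ‖w‖ ^ 2 + ‖a‖ ^ 2 + 2 * (w.re * a.re + w.im * a.im) := by
    simp only [Complex.sq_norm, Complex.normSq_apply, Complex.add_re, Complex.add_im]; ring
  have e2 : ‖1 + (starRingEnd ℂ) a * w‖ ^ 2
      = 1 + ‖w‖ ^ 2 * ‖a‖ ^ 2 + 2 * (w.re * a.re + w.im * a.im) := by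
    simp only [Complex.sq_norm, Complex.normSq_apply, Complex.add_re, Complex.add_im,
      Complex.mul_re, Complex.mul_im, Complex.conj_re, Complex.conj_im, Complex.one_re,
      Complex.one_im]
    ring
  rw [e1, e2]
  have h1 : ‖a‖ ^ 2 < 1 := by nlinarith [norm_nonneg a]
  have h2 : ‖w‖ ^ 2 < 1 := by nlinarith [norm_nonneg w]
  nlinarith

theorem differentiableOn_diskAut {a : ℂ} (ha : ‖a‖ < 1) :
    DifferentiableOn ℂ (diskAut a) (disk 1) := fun _ hw =>
  (hasDerivAt_diskAut ha (mem_ball_zero_iff.mp hw)).differentiableAt.differentiableWithinAt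

theorem isSelfMap_diskAut {a : ℂ} (ha : ‖a‖ < 1) : IsSelfMap (diskAut a) :=
  ⟨differentiableOn_diskAut ha, diskAut_mapsTo ha⟩

theorem differentiableAt_of_disk {f : ℂ → ℂ} {r : ℝ} (hf : DifferentiableOn ℂ f (disk r)) {z : ℂ}
    (hz : ‖z‖ < r) : DifferentiableAt ℂ f z :=
  hf.differentiableAt (isOpen_ball.mem_nhds (mem_ball_zero_iff.mpr hz))

/-- The **Schwarz-Pick lemma** for the derivative. -/
theorem IsSelfMap.norm_deriv_mul_le {φ : ℂ → ℂ} (hφ : IsSelfMap φ) {z : ℂ} (hz : ‖z‖ < 1) :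
    ‖deriv φ z‖ * (1 - ‖z‖ ^ 2) ≤ 1 - ‖φ z‖ ^ 2 := by
  have hb : ‖φ z‖ < 1 := mem_ball_zero_iff.mp (hφ.mapsTo (mem_ball_zero_iff.mpr hz))
  have hb' : ‖-φ z‖ < 1 := by rwa [norm_neg]
  -- Automorphisms on both sides move `z` and `φ z` to the origin, where Schwarz's lemma applies.
  have hd : DifferentiableOn ℂ (diskAut (-φ z) ∘ φ ∘ diskAut z) (disk 1) :=
    (differentiableOn_diskAut hb').comp
      (hφ.analytic.comp (differentiableOn_diskAut hz) (diskAut_mapsTo hz))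
      (hφ.mapsTo.comp (diskAut_mapsTo hz))
  have hm : MapsTo (diskAut (-φ z) ∘ φ ∘ diskAut z) (disk 1) (disk 1) :=
    (diskAut_mapsTo hb').comp (hφ.mapsTo.comp (diskAut_mapsTo hz))
  have h0 : diskAut z 0 = z := by simp [diskAut]
  have hc0 : (diskAut (-φ z) ∘ φ ∘ diskAut z) 0 = 0 := by simp [diskAut]
  have hle := Complex.norm_deriv_le_one_of_mapsTo_ball hd
    (by rw [hc0]; exact hm.mono_right ball_subset_closedBall) one_pos
  have d1 : HasDerivAt (diskAut z) ((1 - ‖z‖ ^ 2 : ℝ) : ℂ) 0 := by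
    simpa using hasDerivAt_diskAut hz (w := 0) (by simp)
  have d2 : HasDerivAt φ (deriv φ z) (diskAut z 0) := by
    rw [h0]; exact (differentiableAt_of_disk hφ.analytic hz).hasDerivAt
  have d3 := hasDerivAt_diskAut hb' hb
  have e3 : ((1 - ‖-φ z‖ ^ 2 : ℝ) : ℂ) / (1 + (starRingEnd ℂ) (-φ z) * φ z) ^ 2
      = (((1 - ‖φ z‖ ^ 2)⁻¹ : ℝ) : ℂ) := by
    have h3 : (starRingEnd ℂ) (φ z) * φ z = ((‖φ z‖ : ℂ)) ^ 2 := Complex.conj_mul' _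
    have hp : (1 - (‖φ z‖ : ℂ) ^ 2) ≠ 0 := by
      have : (0 : ℝ) < 1 - ‖φ z‖ ^ 2 := by nlinarith [norm_nonneg (φ z)]
      exact_mod_cast this.ne'
    rw [map_neg, neg_mul, h3, norm_neg, ← sub_eq_add_neg]
    push_cast
    field_simp
  rw [e3] at d3
  have d4 : HasDerivAt (diskAut (-φ z) ∘ φ ∘ diskAut z) _ 0 :=
    HasDerivAt.comp (0 : ℂ) (by simpa only [Function.comp_apply, h0] using d3) (d2.comp (0 : ℂ) d1)
  rw [d4.deriv, norm_mul, norm_mul, Complex.norm_real, Complex.norm_real, Real.norm_eq_abs,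
    Real.norm_eq_abs, abs_of_pos, abs_of_pos, inv_mul_le_iff₀, mul_one] at hle
  · exact hle
  all_goals try rw [inv_pos]
  all_goals nlinarith [norm_nonneg (φ z), norm_nonneg z]

/-! ### The minimum modulus -/

theorem IsMaMinda.ne_zero {ψ : ℂ → ℂ} (hψ : IsMaMinda ψ) {z : ℂ} (hz : ‖z‖ < 1) : ψ z ≠ 0 := by
  intro h
  have := hψ.re_pos z (mem_ball_zero_iff.mpr hz)
  simp [h] at this

theorem minModulus_pos {ψ : ℂ → ℂ} (hψ : IsMaMinda ψ) {r : ℝ} (h0 : 0 ≤ r) (h1 : r < 1) :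
    0 < minModulus ψ r := by
  obtain ⟨z, hz, he⟩ := (isLeast_minModulus hψ h0 h1).1
  rw [← he]
  exact norm_pos_iff.mpr (hψ.ne_zero (by rwa [mem_sphere_zero_iff_norm.mp hz]))

/-- Maximum principle for `1 / ψ`, which is analytic because `Re ψ > 0`. -/
theorem minModulus_le_norm {ψ : ℂ → ℂ} (hψ : IsMaMinda ψ) {r : ℝ} (h0 : 0 ≤ r) (h1 : r < 1)
    {z : ℂ} (hz : ‖z‖ ≤ r) : minModulus ψ r ≤ ‖ψ z‖ := by
  rcases h0.eq_or_lt with rfl | h0'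
  · exact (isLeast_minModulus hψ le_rfl h1).2
      ⟨z, mem_sphere_zero_iff_norm.mpr (le_antisymm hz (norm_nonneg _)), rfl⟩
  have hpos := minModulus_pos hψ h0 h1
  have hsub : closedBall (0 : ℂ) r ⊆ disk 1 := closedBall_subset_ball h1
  have hd : DifferentiableOn ℂ (fun z => (ψ z)⁻¹) (disk 1) :=
    hψ.analytic.inv fun z hz => hψ.ne_zero (mem_ball_zero_iff.mp hz)
  have hdc : DiffContOnCl ℂ (fun z => (ψ z)⁻¹) (ball 0 r) :=
    DifferentiableOn.diffContOnCl
      (hd.mono (by rw [closure_ball _ h0'.ne']; exact hsub))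
  have := Complex.norm_le_of_forall_mem_frontier_norm_le isBounded_ball hdc
    (C := (minModulus ψ r)⁻¹) (fun w hw => by
      rw [frontier_ball _ h0'.ne'] at hw
      rw [norm_inv]
      exact inv_anti₀ hpos ((isLeast_minModulus hψ h0 h1).2 ⟨w, hw, rfl⟩))
    (z := z) (by rw [closure_ball _ h0'.ne']; exact mem_closedBall_zero_iff.mpr hz)
  rw [norm_inv] at this
  exact (inv_le_inv₀ (norm_pos_iff.mpr (hψ.ne_zero (hz.trans_lt h1))) hpos).mp this

theorem minModulus_antitone {ψ : ℂ → ℂ} (hψ : IsMaMinda ψ) {r s : ℝ} (h0 : 0 ≤ r) (hrs : r ≤ s)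
    (h1 : s < 1) : minModulus ψ s ≤ minModulus ψ r := by
  obtain ⟨z, hz, he⟩ := (isLeast_minModulus hψ h0 (hrs.trans_lt h1)).1
  rw [← he]
  exact minModulus_le_norm hψ (h0.trans hrs) h1 ((mem_sphere_zero_iff_norm.mp hz).trans_le hrs)

theorem minModulus_zero {ψ : ℂ → ℂ} (hψ : IsMaMinda ψ) : minModulus ψ 0 = 1 := by
  obtain ⟨z, hz, he⟩ := (isLeast_minModulus hψ le_rfl one_pos).1
  have : z = 0 := by simpa using hz
  simp [← he, this, hψ.map_zero]

theorem continuousOn_minModulus {ψ : ℂ → ℂ} (hψ : IsMaMinda ψ) {s : ℝ} (h1 : s < 1) :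
    ContinuousOn (minModulus ψ) (Icc 0 s) := by
  rw [continuousOn_iff_continuous_domRestrict]
  -- All the circles are parametrized by the unit circle, so the infimum runs over one fixed compact
  -- set.
  let F : Icc (0 : ℝ) s → sphere (0 : ℂ) 1 → ℝ := fun r u => ‖ψ ((r : ℝ) * (u : ℂ))‖
  have hF : Continuous ↿F := by
    have hc : Continuous fun p : Icc (0 : ℝ) s × sphere (0 : ℂ) 1 =>
        (((p.1 : ℝ) : ℂ) * (p.2 : ℂ)) := by fun_prop
    refine (ContinuousOn.comp_continuous hψ.analytic.continuousOn hc fun p => ?_).norm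
    rw [mem_ball_zero_iff, norm_mul, Complex.norm_real, Real.norm_eq_abs, abs_of_nonneg p.1.2.1,
      mem_sphere_zero_iff_norm.mp p.2.2, mul_one]
    exact p.1.2.2.trans_lt h1
  convert isCompact_univ.continuous_sInf hF using 2 with r
  rw [Set.domRestrict_apply, minModulus]
  congr 1
  ext y
  constructor
  · rintro ⟨z, hz, rfl⟩
    rw [mem_sphere_zero_iff_norm] at hz
    rcases eq_or_ne z 0 with rfl | hz0
    · refine ⟨⟨1, by simp⟩, trivial, ?_⟩
      have : (r : ℝ) = 0 := by simpa using hz.symm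
      simp [F, this]
    · refine ⟨⟨z / ‖z‖, by simp [hz0]⟩, trivial, ?_⟩
      have : (‖z‖ : ℂ) ≠ 0 := by simpa using hz0
      simp only [F, ← hz]
      rw [mul_div_cancel₀ _ this]
  · rintro ⟨u, -, rfl⟩
    refine ⟨(r : ℝ) * (u : ℂ), ?_, rfl⟩
    rw [mem_sphere_zero_iff_norm, norm_mul, Complex.norm_real, Real.norm_eq_abs,
      abs_of_nonneg r.2.1, mem_sphere_zero_iff_norm.mp u.2, mul_one]

theorem radiusEquation_strictAnti {ψ : ℂ → ℂ} (hψ : IsMaMinda ψ) {r s : ℝ} (h0 : 0 ≤ r)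
    (hrs : r < s) (h1 : s < 1) :
    (1 - s ^ 2) * minModulus ψ s - 2 * s < (1 - r ^ 2) * minModulus ψ r - 2 * r := by
  have hm := minModulus_antitone hψ h0 hrs.le h1
  have hp := minModulus_pos hψ h0 (hrs.trans h1)
  have : (1 - s ^ 2) * minModulus ψ s ≤ (1 - r ^ 2) * minModulus ψ r := by
    apply mul_le_mul _ hm (minModulus_pos hψ (h0.trans hrs.le) h1).le <;> nlinarith
  linarith

theorem existsUnique_isRadiusRoot {ψ : ℂ → ℂ} (hψ : IsMaMinda ψ) : ∃! r : ℝ, IsRadiusRoot ψ r := by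
  have hc : ContinuousOn (fun r => (1 - r ^ 2) * minModulus ψ r - 2 * r) (Icc 0 (1 / 2 : ℝ)) := by
    have := continuousOn_minModulus hψ (s := 1 / 2) (by norm_num)
    fun_prop
  -- This makes the left side of the equation at most `3/4 - 1 < 0` at `r = 1/2`; at `r = 0` it is
  -- `1`.
  have hm : minModulus ψ (1 / 2) ≤ 1 :=
    (minModulus_antitone hψ le_rfl (by norm_num) (by norm_num)).trans_eq (minModulus_zero hψ)
  obtain ⟨r, hr, he⟩ := intermediate_value_Icc' (by norm_num) hc
    (show (0 : ℝ) ∈ Icc _ _ from ⟨by linarith, by rw [minModulus_zero hψ]; norm_num⟩)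
  have hr0 : 0 < r := by
    refine hr.1.lt_of_ne ?_
    rintro rfl
    simp [minModulus_zero hψ] at he
  refine ⟨r, ⟨hr0, by linarith [hr.2], he⟩, ?_⟩
  rintro s ⟨hs0, hs1, hse⟩
  rcases lt_trichotomy s r with h | h | h
  · have := radiusEquation_strictAnti hψ hs0.le h (by linarith [hr.2])
    simp only at he
    linarith
  · exact h
  · have := radiusEquation_strictAnti hψ hr0.le h hs1
    simp only at he
    linarith

/-! ### Derivatives of harmonic mappings -/

theorem wirtinger_and_wirtingerBar_add_conj {f h g : ℂ → ℂ} {h' g' z : ℂ}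
    (hh : HasDerivAt h h' z) (hg : HasDerivAt g g' z)
    (hf : f =ᶠ[nhds z] fun w => h w + (starRingEnd ℂ) (g w)) :
    wirtinger f z = h' ∧ wirtingerBar f z = (starRingEnd ℂ) g' := by
  have h1 := hh.hasFDerivAt.restrictScalars ℝ
  have h2 := hg.hasFDerivAt.restrictScalars ℝ
  have h3 : HasFDerivAt (fun w => (starRingEnd ℂ) (g w)) _ z :=
    (Complex.conjCLE.toContinuousLinearMap.hasFDerivAt (x := g z)).comp z h2
  have h4 : HasFDerivAt f _ z := (h1.add h3).congr_of_eventuallyEq hf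
  have hI : Complex.I ^ 2 = -1 := Complex.I_sq
  constructor
  · rw [wirtinger, h4.fderiv]
    simp
    linear_combination (-(1 : ℂ) / 2 * h' + (starRingEnd ℂ) g' / 2) * hI
  · rw [wirtingerBar, h4.fderiv]
    simp
    linear_combination ((1 : ℂ) / 2 * h' - (starRingEnd ℂ) g' / 2) * hI

theorem jacobian_add_conj {f h g : ℂ → ℂ} {h' g' z : ℂ}
    (hh : HasDerivAt h h' z) (hg : HasDerivAt g g' z)
    (hf : f =ᶠ[nhds z] fun w => h w + (starRingEnd ℂ) (g w)) :
    jacobian f z = ‖h'‖ ^ 2 - ‖g'‖ ^ 2 := by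
  obtain ⟨h1, h2⟩ := wirtinger_and_wirtingerBar_add_conj hh hg hf
  rw [jacobian, h1, h2, Complex.norm_conj]

/-! ### Convex univalent functions -/

theorem hasDerivAt_invFunOn {h : ℂ → ℂ} {U : Set ℂ} (hU : IsOpen U) (hd : DifferentiableOn ℂ h U)
    (hi : InjOn h U) {z : ℂ} (hz : z ∈ U) (hne : deriv h z ≠ 0) :
    HasDerivAt (Function.invFunOn h U) (deriv h z)⁻¹ (h z) := by
  have hs : HasStrictDerivAt h (deriv h z) z := (hd.analyticAt (hU.mem_nhds hz)).hasStrictDerivAt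
  refine (hs.to_local_left_inverse hne ?_).hasDerivAt
  filter_upwards [hU.mem_nhds hz] with w hw
  exact hi.leftInvOn_invFunOn hw

/-- With `c = z₁ / z₂`, the function `s h(c z) + t h(z)` takes values in the convex image of `h`.
Composing it with `h⁻¹` gives a self-map of the disk fixing `0`, and Schwarz's lemma at `z₂` bounds
the preimage. -/
theorem ConvexUnivalentOn.exists_norm_le {h : ℂ → ℂ} {r : ℝ} (hc : ConvexUnivalentOn h (disk r))
    (hd : DifferentiableOn ℂ h (disk r)) (hne : ∀ z ∈ disk r, deriv h z ≠ 0) {z₁ z₂ : ℂ}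
    (h12 : ‖z₁‖ ≤ ‖z₂‖) (h2 : ‖z₂‖ < r) {s t : ℝ} (hs : 0 ≤ s) (ht : 0 ≤ t) (hst : s + t = 1) :
    ∃ w : ℂ, ‖w‖ ≤ ‖z₂‖ ∧ h w = s • h z₁ + t • h z₂ := by
  rcases eq_or_ne z₂ 0 with rfl | hz2
  · have : z₁ = 0 := by simpa using h12
    subst this
    exact ⟨0, le_rfl, by rw [← add_smul, hst, one_smul]⟩
  have hr : 0 < r := (norm_nonneg _).trans_lt h2
  have hcn : ‖z₁ / z₂‖ ≤ 1 := by
    rw [norm_div]; exact div_le_one_of_le₀ h12 (norm_nonneg _)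
  have hm1 : MapsTo (fun z => z₁ / z₂ * z) (disk r) (disk r) := by
    intro z hz
    rw [mem_ball_zero_iff] at hz ⊢
    rw [norm_mul]
    exact (mul_le_of_le_one_left (norm_nonneg _) hcn).trans_lt hz
  let F : ℂ → ℂ := fun z => s • h (z₁ / z₂ * z) + t • h z
  have hF : MapsTo F (disk r) (h '' disk r) := fun z hz =>
    hc.2 (mem_image_of_mem h (hm1 hz)) (mem_image_of_mem h hz) hs ht hst
  have hFd : DifferentiableOn ℂ F (disk r) :=
    ((hd.comp (f := fun z => z₁ / z₂ * z) (by fun_prop) hm1).const_smul s).add (hd.const_smul t)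
  let G : ℂ → ℂ := Function.invFunOn h (disk r) ∘ F
  have hGm : MapsTo G (disk r) (disk r) := fun z hz => Function.invFunOn_mem (hF hz)
  have hGd : DifferentiableOn ℂ G (disk r) := by
    intro z hz
    obtain ⟨w, hw, hwe⟩ := hF hz
    have := (hasDerivAt_invFunOn isOpen_ball hd hc.1 hw (hne w hw)).differentiableAt
    rw [hwe] at this
    exact this.comp_differentiableWithinAt z (hFd z hz)
  have h0 : (0 : ℂ) ∈ disk r := mem_ball_self hr
  have hG0 : G 0 = 0 := by
    have : F 0 = h 0 := by
      simp only [F, mul_zero]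
      rw [← add_smul, hst, one_smul]
    simp only [G, Function.comp_apply, this]
    exact hc.1.leftInvOn_invFunOn h0
  refine ⟨G z₂, Complex.norm_le_norm_of_mapsTo_ball hGd
    (hGm.mono_right ball_subset_closedBall) hG0 h2, ?_⟩
  have : h (G z₂) = F z₂ := Function.invFunOn_eq (hF (mem_ball_zero_iff.mpr h2))
  rw [this]
  simp only [F, div_mul_cancel₀ _ hz2]

/-- **Study's theorem**: a convex univalent function is convex on smaller concentric disks. -/
theorem ConvexUnivalentOn.mono {h : ℂ → ℂ} {r ρ : ℝ} (hc : ConvexUnivalentOn h (disk r))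
    (hd : DifferentiableOn ℂ h (disk r)) (hne : ∀ z ∈ disk r, deriv h z ≠ 0) (hρ : ρ ≤ r) :
    ConvexUnivalentOn h (disk ρ) := by
  refine ⟨hc.1.mono (ball_subset_ball hρ), ?_⟩
  rintro _ ⟨z₁, h1, rfl⟩ _ ⟨z₂, h2, rfl⟩ s t hs ht hst
  rw [mem_ball_zero_iff] at h1 h2
  rcases le_total ‖z₁‖ ‖z₂‖ with h12 | h12
  · obtain ⟨w, hw, he⟩ := hc.exists_norm_le hd hne h12 (h2.trans_le hρ) hs ht hst
    exact ⟨w, mem_ball_zero_iff.mpr (hw.trans_lt h2), he⟩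
  · obtain ⟨w, hw, he⟩ := hc.exists_norm_le hd hne h12 (h1.trans_le hρ) ht hs
      ((add_comm t s).trans hst)
    exact ⟨w, mem_ball_zero_iff.mpr (hw.trans_lt h1), he.trans (add_comm _ _)⟩

/-- A harmonic mapping with convex univalent analytic part is univalent where it is
sense-preserving. -/
theorem ConvexUnivalentOn.injOn_add_conj {h g : ℂ → ℂ} {U : Set ℂ} (hc : ConvexUnivalentOn h U)
    (hU : IsOpen U) (hh : DifferentiableOn ℂ h U) (hg : DifferentiableOn ℂ g U)
    (hlt : ∀ z ∈ U, ‖deriv g z‖ < ‖deriv h z‖) :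
    InjOn (fun z => h z + (starRingEnd ℂ) (g z)) U := by
  intro a ha b hb hab
  by_contra hne
  have hnh : h b - h a ≠ 0 := sub_ne_zero.mpr fun e => hne (hc.1 ha hb e.symm)
  have hnorm : ‖g b - g a‖ = ‖h b - h a‖ := by
    have : h b - h a = -(starRingEnd ℂ) (g b - g a) := by
      rw [map_sub]
      simp only at hab
      linear_combination -hab
    rw [this, norm_neg, Complex.norm_conj]
  -- The segment from `h a` to `h b` stays in the convex image; along it `g ∘ h⁻¹` has speed less
  -- than `|h b - h a|`, yet must cover exactly that distance.
  let γ : ℝ → ℂ := fun t => h a + t • (h b - h a)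
  have hγ : ∀ t ∈ Icc (0 : ℝ) 1, γ t ∈ h '' U := fun t ht =>
    hc.2.add_smul_sub_mem (mem_image_of_mem h ha) (mem_image_of_mem h hb) ht
  have hγd : ∀ t, HasDerivAt γ (h b - h a) t := fun t => by
    simpa [γ] using ((hasDerivAt_id t).smul_const (h b - h a)).const_add (h a)
  let H := Function.invFunOn h U
  have hH : ∀ z ∈ U, H (h z) = z := fun z hz => hc.1.leftInvOn_invFunOn hz
  have hkd : ∀ t ∈ Icc (0 : ℝ) 1, ∃ z ∈ U,
      HasDerivAt (fun t => g (H (γ t))) (deriv g z * ((deriv h z)⁻¹ * (h b - h a))) t := by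
    intro t ht
    obtain ⟨z, hz, hze⟩ := hγ t ht
    have hdz : deriv h z ≠ 0 := norm_pos_iff.mp ((norm_nonneg _).trans_lt (hlt z hz))
    refine ⟨z, hz, ?_⟩
    have h1 := hasDerivAt_invFunOn hU hh hc.1 hz hdz
    have h2 : HasDerivAt g (deriv g z) (H (γ t)) := by
      rw [← hze, hH z hz]
      exact (hg.differentiableAt (hU.mem_nhds hz)).hasDerivAt
    rw [hze] at h1
    exact HasDerivAt.comp t h2 (HasDerivAt.comp t h1 (hγd t))
  -- Projecting onto the direction of `g b - g a` makes the mean value theorem available; the slope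
  -- becomes `|g b - g a|²`.
  let u := (starRingEnd ℂ) (g b - g a)
  have hre : ∀ {k : ℝ → ℂ} {k' : ℂ} {t : ℝ}, HasDerivAt k k' t →
      HasDerivAt (fun t => (u * k t).re) (u * k').re t := fun {k k' t} hk =>
    (Complex.reCLM.hasFDerivAt.comp_hasDerivAt t (hk.const_mul u))
  choose! ζ hζ hζd using hkd
  obtain ⟨t, ht, hte⟩ := exists_hasDerivAt_eq_slope _ _ (zero_lt_one' ℝ)
    (fun t ht => (hre (hζd t ht)).continuousAt.continuousWithinAt)
    (fun t ht => hre (hζd t (Ioo_subset_Icc_self ht)))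
  have ht' := Ioo_subset_Icc_self ht
  have e0 : H (γ 0) = a := by simp only [γ, zero_smul, add_zero, hH a ha]
  have e1 : H (γ 1) = b := by simp only [γ, one_smul, add_sub_cancel, hH b hb]
  rw [e0, e1, sub_zero, div_one, ← Complex.sub_re, ← mul_sub, Complex.conj_mul',
    ← Complex.ofReal_pow, Complex.ofReal_re] at hte
  have hlt' := hlt _ (hζ t ht')
  have hpos : 0 < ‖deriv h (ζ t)‖ := (norm_nonneg _).trans_lt hlt'
  have hgp : 0 < ‖h b - h a‖ := norm_pos_iff.mpr hnh
  have hb1 := (le_abs_self _).trans (Complex.abs_re_le_norm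
    (u * (deriv g (ζ t) * ((deriv h (ζ t))⁻¹ * (h b - h a)))))
  rw [hte, norm_mul, norm_mul, norm_mul, norm_inv, Complex.norm_conj, hnorm] at hb1
  have hq : ‖deriv g (ζ t)‖ * ‖deriv h (ζ t)‖⁻¹ < 1 := by
    rw [← div_eq_mul_inv]; exact (div_lt_one hpos).mpr hlt'
  nlinarith [mul_pos hgp hgp]

/-! ### The class `S*(ψ)` -/

theorem MaMindaStarlike.exists_mul_deriv_eq {ψ h : ℂ → ℂ} (hh : MaMindaStarlike ψ h) {z : ℂ}
    (hz : ‖z‖ < 1) (hz0 : z ≠ 0) : ∃ w : ℂ, ‖w‖ ≤ ‖z‖ ∧ z * deriv h z = ψ w * h z := by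
  obtain ⟨ω, hω, hω0, he⟩ := hh.subordinate
  refine ⟨ω z, Complex.norm_le_norm_of_mapsTo_ball hω.analytic
    (hω.mapsTo.mono_right ball_subset_closedBall) hω0 hz, ?_⟩
  have := he z (mem_ball_zero_iff.mpr hz)
  rwa [starQuotient, if_neg hz0, div_eq_iff (hh.ne_zero z (mem_ball_zero_iff.mpr hz) hz0)] at this

theorem MaMindaStarlike.deriv_ne_zero {ψ h : ℂ → ℂ} (hψ : IsMaMinda ψ) (hh : MaMindaStarlike ψ h)
    {z : ℂ} (hz : ‖z‖ < 1) : deriv h z ≠ 0 := by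
  rcases eq_or_ne z 0 with rfl | hz0
  · simp [hh.deriv_zero]
  obtain ⟨w, hw, he⟩ := hh.exists_mul_deriv_eq hz hz0
  intro h0
  rw [h0, mul_zero, eq_comm, mul_eq_zero] at he
  exact he.elim (hψ.ne_zero (hw.trans_lt hz)) (hh.ne_zero z (mem_ball_zero_iff.mpr hz) hz0)

theorem MaMindaStarlike.minModulus_mul_norm_le {ψ h : ℂ → ℂ} (hψ : IsMaMinda ψ)
    (hh : MaMindaStarlike ψ h) {z : ℂ} (hz : ‖z‖ < 1) :
    minModulus ψ ‖z‖ * ‖h z‖ ≤ ‖z‖ * ‖deriv h z‖ := by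
  rcases eq_or_ne z 0 with rfl | hz0
  · simp [hh.map_zero]
  obtain ⟨w, hw, he⟩ := hh.exists_mul_deriv_eq hz hz0
  rw [← norm_mul, he, norm_mul]
  exact mul_le_mul_of_nonneg_right (minModulus_le_norm hψ (norm_nonneg _) hz hw) (norm_nonneg _)

theorem MaMindaStarlike.norm_deriv_mul_lt {ψ h φ : ℂ → ℂ} (hψ : IsMaMinda ψ)
    (hh : MaMindaStarlike ψ h) (hφ : IsSelfMap φ) {r : ℝ} (hr : IsRadiusRoot ψ r) {z : ℂ}
    (hz : ‖z‖ < r) : ‖deriv (fun z => φ z * h z) z‖ < ‖deriv h z‖ := by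
  have hz1 : ‖z‖ < 1 := hz.trans hr.2.1
  have hm := minModulus_pos hψ (norm_nonneg z) hz1
  have hroot := radiusEquation_strictAnti hψ (norm_nonneg z) hz hr.2.1
  rw [hr.2.2] at hroot
  have hSP := hφ.norm_deriv_mul_le hz1
  have hle := hh.minModulus_mul_norm_le hψ hz1
  have hpos : 0 < ‖deriv h z‖ := norm_pos_iff.mpr (hh.deriv_ne_zero hψ hz1)
  have hφ1 : ‖φ z‖ < 1 := mem_ball_zero_iff.mp (hφ.mapsTo (mem_ball_zero_iff.mpr hz1))
  have hd : deriv (fun z => φ z * h z) z = deriv φ z * h z + φ z * deriv h z :=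
    ((differentiableAt_of_disk hφ.analytic hz1).hasDerivAt.mul
      (differentiableAt_of_disk hh.analytic hz1).hasDerivAt).deriv
  have hN : ‖deriv (fun z => φ z * h z) z‖ ≤ ‖deriv φ z‖ * ‖h z‖ + ‖φ z‖ * ‖deriv h z‖ := by
    rw [hd, ← norm_mul, ← norm_mul]; exact norm_add_le _ _
  refine hN.trans_lt ?_
  set p := ‖deriv φ z‖
  set q := ‖h z‖
  set d := ‖deriv h z‖
  set c := ‖φ z‖
  set x := ‖z‖
  set m := minModulus ψ x
  have hx : 0 ≤ x := norm_nonneg z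
  have hc : 0 ≤ c := norm_nonneg _
  have hx2 : 0 < 1 - x ^ 2 := by nlinarith
  have h1 : (p * (1 - x ^ 2)) * (m * q) ≤ (1 - c ^ 2) * (x * d) :=
    mul_le_mul hSP hle (by positivity) (by nlinarith)
  have hK : 0 < (1 - x ^ 2) * m := mul_pos hx2 hm
  have h2 : 2 * x * ((1 - c ^ 2) * d) < (1 - x ^ 2) * m * ((1 - c ^ 2) * d) :=
    mul_lt_mul_of_pos_right (by linarith) (mul_pos (by nlinarith) hpos)
  have h3 : p * q < (1 - c ^ 2) * d / 2 := by
    refine lt_of_mul_lt_mul_left (a := (1 - x ^ 2) * m) ?_ hK.le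
    nlinarith
  -- The bound closes because `(1 - c²) / 2 + c = 1 - (1 - c)² / 2`.
  nlinarith [mul_nonneg (sq_nonneg (1 - c)) hpos.le]

theorem HarmonicClass.sensePreservingOn_and_injOn {ψ f : ℂ → ℂ} (hψ : IsMaMinda ψ) {r : ℝ}
    (hr : IsRadiusRoot ψ r) (hf : HarmonicClass ψ f) :
    SensePreservingOn f (disk (min r (radiusOfConvexity ψ))) ∧
      InjOn f (disk (min r (radiusOfConvexity ψ))) := by
  obtain ⟨h, g, φ, hh, hφ, hg, hfe⟩ := hf
  have hfe' : ∀ z ∈ disk 1, f z = h z + (starRingEnd ℂ) (φ z * h z) := fun z hz => by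
    rw [hfe z hz, hg z hz]
  have hgd : DifferentiableOn ℂ (fun z => φ z * h z) (disk 1) := hφ.analytic.mul hh.analytic
  constructor
  · intro z hz
    have hzr : ‖z‖ < r := (mem_ball_zero_iff.mp hz).trans_le (min_le_left _ _)
    have hz1 : ‖z‖ < 1 := hzr.trans hr.2.1
    rw [jacobian_add_conj (differentiableAt_of_disk hh.analytic hz1).hasDerivAt
      (differentiableAt_of_disk hgd hz1).hasDerivAt
      (Filter.eventuallyEq_of_mem (isOpen_ball.mem_nhds (mem_ball_zero_iff.mpr hz1)) hfe')]
    have := hh.norm_deriv_mul_lt hψ hφ hr hzr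
    exact sub_pos.mpr (pow_lt_pow_left₀ this (norm_nonneg _) two_ne_zero)
  · intro a ha b hb hab
    rw [mem_ball_zero_iff, lt_min_iff] at ha hb
    have hlt : max ‖a‖ ‖b‖ < radiusOfConvexity ψ := max_lt ha.2 hb.2
    -- The supremum of the empty set is `0`, which cannot exceed a norm.
    have hne : {s : ℝ | 0 < s ∧ s ≤ 1 ∧
        ∀ h, MaMindaStarlike ψ h → ConvexUnivalentOn h (disk s)}.Nonempty := by
      by_contra hemp
      rw [not_nonempty_iff_eq_empty] at hemp
      rw [radiusOfConvexity, hemp, Real.sSup_empty] at hlt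
      exact absurd (le_max_left ‖a‖ ‖b‖) (by linarith [norm_nonneg a])
    obtain ⟨s, ⟨hs0, hs1, hs⟩, hlts⟩ := exists_lt_of_lt_csSup hne hlt
    have hsub : disk s ⊆ disk 1 := ball_subset_ball hs1
    have hsub' : disk (min r s) ⊆ disk 1 := ball_subset_ball ((min_le_right _ _).trans hs1)
    -- `s` may exceed `r`, whereas `|g'| < |h'|` is known only below `r`; Study's theorem carries
    -- convexity down to the smaller disk.
    have hc : ConvexUnivalentOn h (disk (min r s)) :=
      (hs h hh).mono (hh.analytic.mono hsub)
        (fun z hz => hh.deriv_ne_zero hψ (mem_ball_zero_iff.mp (hsub hz))) (min_le_right _ _)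
    have ha' : a ∈ disk (min r s) :=
      mem_ball_zero_iff.mpr (lt_min ha.1 ((le_max_left _ _).trans_lt hlts))
    have hb' : b ∈ disk (min r s) :=
      mem_ball_zero_iff.mpr (lt_min hb.1 ((le_max_right _ _).trans_lt hlts))
    refine hc.injOn_add_conj isOpen_ball (hh.analytic.mono hsub') (hgd.mono hsub')
      (fun z hz => hh.norm_deriv_mul_lt hψ hφ hr
        ((mem_ball_zero_iff.mp hz).trans_le (min_le_left _ _))) ha' hb' ?_
    rwa [hfe' a (hsub' ha'), hfe' b (hsub' hb')] at hab

/-! ### Sharpness -/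

/-- The function `h` with `z h' / h = ψ`. -/
theorem IsMaMinda.exists_extremal {ψ : ℂ → ℂ} (hψ : IsMaMinda ψ)
    (hreal : ∀ x : ℝ, 0 < x → x < 1 → (ψ (-(x : ℂ))).im = 0) :
    ∃ h : ℂ → ℂ, MaMindaStarlike ψ h ∧ (∀ z ∈ disk 1, z * deriv h z = ψ z * h z) ∧
      ∀ x : ℝ, 0 < x → x < 1 → ∃ e : ℝ, 0 < e ∧ h (-(x : ℂ)) = ((-(x * e) : ℝ) : ℂ) := by
  -- `h = z exp P`, where `P` is the primitive of `(ψ z - 1) / z` with `P 0 = 0`.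
  have hψd : DifferentiableOn ℂ (dslope ψ 0) (disk 1) :=
    (Complex.differentiableOn_dslope (ball_mem_nhds 0 one_pos)).mpr hψ.analytic
  obtain ⟨P, hP0, hP⟩ := hψd.isExactOn_ball.with_val_at 0 0
  have hsl : ∀ z, z * dslope ψ 0 z = ψ z - 1 := fun z => by
    simpa [hψ.map_zero] using sub_smul_dslope ψ 0 z
  have hd : ∀ z ∈ disk 1, HasDerivAt (fun z => z * Complex.exp (P z))
      (ψ z * Complex.exp (P z)) z := fun z hz =>
    ((hasDerivAt_id z).mul (hP z hz).cexp).congr_deriv (by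
      simp only [id]; linear_combination Complex.exp (P z) * hsl z)
  have h0 : (0 : ℂ) ∈ disk 1 := mem_ball_self one_pos
  have hne : ∀ z ∈ disk 1, z ≠ 0 → z * Complex.exp (P z) ≠ 0 := fun z _ hz =>
    mul_ne_zero hz (Complex.exp_ne_zero _)
  have hmul : ∀ z ∈ disk 1, z * deriv (fun z => z * Complex.exp (P z)) z
      = ψ z * (z * Complex.exp (P z)) := fun z hz => by
    rw [(hd z hz).deriv]; ring
  refine ⟨fun z => z * Complex.exp (P z), ⟨fun z hz =>
    (hd z hz).differentiableAt.differentiableWithinAt, by simp, ?_, hne, ?_⟩, hmul, ?_⟩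
  · rw [(hd 0 h0).deriv, hP0, hψ.map_zero, Complex.exp_zero, mul_one]
  · refine ⟨id, ⟨differentiableOn_id, mapsTo_id _⟩, rfl, fun z hz => ?_⟩
    rw [starQuotient]
    split_ifs with hz0
    · rw [hz0, id, hψ.map_zero]
    · rw [hmul z hz, mul_div_cancel_right₀ _ (hne z hz hz0), id]
  · intro x hx0 hx1
    have hmem : ∀ t ∈ Icc 0 x, -(t : ℂ) ∈ disk 1 := fun t ht => by
      rw [mem_ball_zero_iff, norm_neg, Complex.norm_real, Real.norm_eq_abs, abs_of_nonneg ht.1]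
      exact ht.2.trans_lt hx1
    -- `P'` is real on the negative radius and `P 0 = 0`, so `P` is real there and `e = exp P(-x)`
    -- is positive.
    have hder : ∀ t ∈ Icc 0 x,
        HasDerivAt (fun t : ℝ => (P (-(t : ℂ))).im) (dslope ψ 0 (-(t : ℂ)) * -1).im t :=
      fun t ht => by
        have h1 : HasDerivAt (fun t : ℝ => -(t : ℂ)) (-1) t :=
          (Complex.ofRealCLM.hasDerivAt (x := t)).neg
        exact Complex.imCLM.hasFDerivAt.comp_hasDerivAt t
          (HasDerivAt.comp t (hP _ (hmem t ht)) h1)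
    obtain ⟨t, ht, hte⟩ := exists_hasDerivAt_eq_slope _ _ hx0
      (fun t ht => (hder t ht).continuousAt.continuousWithinAt)
      (fun t ht => hder t (Ioo_subset_Icc_self ht))
    have him : (dslope ψ 0 (-(t : ℂ)) * -1).im = 0 := by
      have h1 := congrArg Complex.im (hsl (-(t : ℂ)))
      rw [Complex.sub_im, hreal t ht.1 (ht.2.trans hx1)] at h1
      simpa [ht.1.ne'] using h1
    rw [him, eq_comm, div_eq_zero_iff] at hte
    have hPx : (P (-(x : ℂ))).im = 0 := by
      simpa [hP0, hx0.ne'] using hte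
    refine ⟨Real.exp (P (-(x : ℂ))).re, Real.exp_pos _, ?_⟩
    have : P (-(x : ℂ)) = ((P (-(x : ℂ))).re : ℂ) := Complex.ext (by simp) (by simpa using hPx)
    push_cast
    rw [← this]
    ring

theorem diskAut_neg_ofReal (a x : ℝ) :
    diskAut (-(a : ℂ)) (-(x : ℂ)) = ((-((x + a) / (1 + a * x)) : ℝ) : ℂ) := by
  rw [diskAut, map_neg, Complex.conj_ofReal]
  push_cast
  rw [← neg_div]
  congr 1 <;> ring

/-- At `a = 1` the inequality reads `(1 - x²) m(x) < 2 x`, up to the factor `1 + x` expanded; this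
holds past the root and persists for `a < 1` close to `1`. -/
theorem IsRadiusRoot.exists_parameter {ψ : ℂ → ℂ} (hψ : IsMaMinda ψ) {r x : ℝ}
    (hr : IsRadiusRoot ψ r) (hrx : r < x) (hx1 : x < 1) :
    ∃ a : ℝ, 0 < a ∧ a < 1 ∧ minModulus ψ x * (1 + a * x) * (1 - x) < (1 + a) * x := by
  have hlt := radiusEquation_strictAnti hψ hr.1.le hrx hx1
  rw [hr.2.2] at hlt
  have hc1 : Continuous fun a : ℝ => minModulus ψ x * (1 + a * x) * (1 - x) := by fun_prop
  have hc2 : Continuous fun a : ℝ => (1 + a) * x := by fun_prop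
  have hev : ∀ᶠ a in nhds (1 : ℝ),
      0 < a ∧ minModulus ψ x * (1 + a * x) * (1 - x) < (1 + a) * x :=
    (lt_mem_nhds one_pos).and
      (hc1.continuousAt.eventually_lt hc2.continuousAt (by linarith))
  obtain ⟨a, ⟨h0, h⟩, h1⟩ := ((hev.filter_mono nhdsWithin_le_nhds).and
    (self_mem_nhdsWithin (s := Iio (1 : ℝ)))).exists
  exact ⟨a, h0, h1, h⟩

/-- At `-x` the choice of `a` gives `|g'| > |h'|`. The real function `F t = f (-t)` has `F 0 = 0`
and `F s ≤ 0`, so injectivity would make it decreasing on `[0, s]`, but `F' x > 0` at the interior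
point `x`. -/
theorem IsRadiusRoot.exists_harmonicClass_not_injOn {ψ : ℂ → ℂ} (hψ : IsMaMinda ψ) {r ρ : ℝ}
    (hr : IsRadiusRoot ψ r)
    (hm : ∀ x : ℝ, 0 < x → x < 1 → ψ (-(x : ℂ)) = (minModulus ψ x : ℂ))
    (hrρ : r < ρ) (hρ : ρ ≤ 1) :
    ∃ f : ℂ → ℂ, HarmonicClass ψ f ∧ ¬ SensePreservingOn f (disk ρ) ∧ ¬ InjOn f (disk ρ) := by
  obtain ⟨h, hh, hmul, hreal⟩ := hψ.exists_extremal
    (fun x hx0 hx1 => by rw [hm x hx0 hx1, Complex.ofReal_im])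
  obtain ⟨x, hrx, hxρ⟩ := exists_between hrρ
  obtain ⟨s, hxs, hsρ⟩ := exists_between hxρ
  have hx0 : 0 < x := hr.1.trans hrx
  have hx1 : x < 1 := hxρ.trans_le hρ
  have hs0 : 0 < s := hx0.trans hxs
  obtain ⟨a, ha0, ha1, ha⟩ := hr.exists_parameter hψ hrx hx1
  have han : ‖-(a : ℂ)‖ < 1 := by
    rw [norm_neg, Complex.norm_real, Real.norm_eq_abs, abs_of_pos ha0]; exact ha1
  have hmem : ∀ t : ℝ, 0 ≤ t → t < ρ → -(t : ℂ) ∈ disk ρ := fun t h0 h1 => by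
    rw [mem_ball_zero_iff, norm_neg, Complex.norm_real, Real.norm_eq_abs, abs_of_nonneg h0]
    exact h1
  have hmem1 : ∀ t : ℝ, 0 ≤ t → t < ρ → ‖-(t : ℂ)‖ < 1 := fun t h0 h1 =>
    (mem_ball_zero_iff.mp (hmem t h0 h1)).trans_le hρ
  let φ := diskAut (-(a : ℂ))
  have hφ : IsSelfMap φ := isSelfMap_diskAut han
  let g : ℂ → ℂ := fun z => φ z * h z
  let f : ℂ → ℂ := fun z => h z + (starRingEnd ℂ) (g z)
  have hgd : DifferentiableOn ℂ g (disk 1) := hφ.analytic.mul hh.analytic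
  have hfr : ∀ t : ℝ, 0 ≤ t → t < ρ → f (-(t : ℂ)) = ((h (-(t : ℂ)) + g (-(t : ℂ))).re : ℂ) := by
    intro t h0 h1
    have him : (h (-(t : ℂ))).im = 0 := by
      rcases h0.eq_or_lt with rfl | h0
      · simp [hh.map_zero]
      · obtain ⟨e, -, he⟩ := hreal t h0 (h1.trans_le hρ)
        rw [he, Complex.ofReal_im]
    have hgim : (g (-(t : ℂ))).im = 0 := by
      simp only [g, φ]
      rw [diskAut_neg_ofReal, Complex.im_ofReal_mul, him, mul_zero]
    apply Complex.ext <;> simp [f, him, hgim]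
  obtain ⟨e, he0, he⟩ := hreal x hx0 hx1
  have hp : 0 < 1 + a * x := by positivity
  -- `δ = φ'(-x)` and `c = -φ(-x)`, so `g'(-x) = -e (δ x + m c)` while `h'(-x) = m e`.
  let δ : ℝ := (1 - a ^ 2) / (1 + a * x) ^ 2
  let c : ℝ := (x + a) / (1 + a * x)
  have hδc : minModulus ψ x < δ * x + minModulus ψ x * c := by
    have : δ * x + minModulus ψ x * c - minModulus ψ x
        = (1 - a) * ((1 + a) * x - minModulus ψ x * (1 + a * x) * (1 - x)) / (1 + a * x) ^ 2 := by
      simp only [δ, c]; field_simp; ring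
    have h2 : 0 < δ * x + minModulus ψ x * c - minModulus ψ x := by
      rw [this]
      exact div_pos (mul_pos (by linarith) (by linarith)) (by positivity)
    linarith
  have hmp := minModulus_pos hψ hx0.le hx1
  have hn := hmem1 x hx0.le hxρ
  have hh' : deriv h (-(x : ℂ)) = ((minModulus ψ x * e : ℝ) : ℂ) := by
    have h1 := hmul _ (mem_ball_zero_iff.mpr hn)
    rw [hm x hx0 hx1, he] at h1
    have hxc : (x : ℂ) ≠ 0 := by exact_mod_cast hx0.ne'
    refine mul_left_cancel₀ hxc ?_
    push_cast at h1 ⊢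
    linear_combination -h1
  have hhd : HasDerivAt h ((minModulus ψ x * e : ℝ) : ℂ) (-(x : ℂ)) := by
    rw [← hh']; exact (differentiableAt_of_disk hh.analytic hn).hasDerivAt
  have hgd' : HasDerivAt g ((-(e * (δ * x + minModulus ψ x * c)) : ℝ) : ℂ) (-(x : ℂ)) := by
    refine ((hasDerivAt_diskAut han hn).mul hhd).congr_deriv ?_
    rw [diskAut_neg_ofReal, he, map_neg, Complex.conj_ofReal, norm_neg, Complex.norm_real,
      Real.norm_eq_abs, sq_abs]
    simp only [δ, c]
    push_cast
    ring
  refine ⟨f, ⟨h, g, φ, hh, hφ, fun _ _ => rfl, fun _ _ => rfl⟩, fun hsp => ?_, fun hinj => ?_⟩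
  · have h1 := hsp _ (hmem x hx0.le hxρ)
    rw [jacobian_add_conj hhd hgd' (Filter.EventuallyEq.refl _ _), Complex.norm_real,
      Complex.norm_real, Real.norm_eq_abs, Real.norm_eq_abs, sq_abs, sq_abs] at h1
    have h2 := mul_lt_mul_of_pos_left hδc he0
    nlinarith [mul_pos hmp he0]
  · let F : ℝ → ℝ := fun t => (h (-(t : ℂ)) + g (-(t : ℂ))).re
    have hFd : ∀ {t : ℝ} {D : ℂ}, HasDerivAt (fun z => h z + g z) D (-(t : ℂ)) →
        HasDerivAt F (D * -1).re t := fun {t D} hD => by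
      have h1 : HasDerivAt (fun t : ℝ => -(t : ℂ)) (-1) t :=
        (Complex.ofRealCLM.hasDerivAt (x := t)).neg
      exact Complex.reCLM.hasFDerivAt.comp_hasDerivAt t (HasDerivAt.comp t hD h1)
    have hFc : ContinuousOn F (Icc 0 s) := fun t ht => by
      have hn := hmem1 t ht.1 (ht.2.trans_lt hsρ)
      exact (hFd ((differentiableAt_of_disk hh.analytic hn).add
        (differentiableAt_of_disk hgd hn)).hasDerivAt).continuousAt.continuousWithinAt
    have hFi : InjOn F (Icc 0 s) := fun t ht u hu htu => by
      have := hinj (hmem t ht.1 (ht.2.trans_lt hsρ)) (hmem u hu.1 (hu.2.trans_lt hsρ)) (by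
        rw [hfr t ht.1 (ht.2.trans_lt hsρ), hfr u hu.1 (hu.2.trans_lt hsρ)]
        exact congrArg _ htu)
      exact_mod_cast neg_injective this
    have hFs : F s ≤ F 0 := by
      obtain ⟨k, hk0, hk⟩ := hreal s hs0 (hsρ.trans_le hρ)
      have hF0 : F 0 = 0 := by simp [F, g, hh.map_zero]
      have hFs : F s = -(s * k) * (1 - (s + a) / (1 + a * s)) := by
        simp only [F, g, φ]
        rw [diskAut_neg_ofReal, hk, ← Complex.ofReal_mul, ← Complex.ofReal_add, Complex.ofReal_re]
        ring
      have hq : (s + a) / (1 + a * s) ≤ 1 := by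
        rw [div_le_one (by positivity)]
        nlinarith [hsρ.trans_le hρ]
      rw [hF0, hFs]
      nlinarith [mul_pos hs0 hk0]
    -- A continuous injective function on an interval is strictly monotone; the endpoint values make
    -- it decreasing.
    have hanti := (hFc.strictAntiOn_of_injOn_Icc hs0.le hFs hFi).antitoneOn
    have hle := hanti.derivWithin_nonpos (x := x)
    rw [derivWithin_of_mem_nhds (Icc_mem_nhds hx0 hxs), (hFd (hhd.add hgd')).deriv,
      ← Complex.ofReal_add, mul_neg_one, Complex.neg_re, Complex.ofReal_re] at hle
    have h2 := mul_lt_mul_of_pos_left hδc he0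
    linarith

end

theorem mainTheorem1 (ψ : ℂ → ℂ) (hψ : IsMaMinda ψ) :
    (∃! r : ℝ, IsRadiusRoot ψ r) ∧
    ∀ rψ : ℝ, IsRadiusRoot ψ rψ →
      (∀ f : ℂ → ℂ, HarmonicClass ψ f →
        SensePreservingOn f (disk (min rψ (radiusOfConvexity ψ))) ∧
        InjOn f (disk (min rψ (radiusOfConvexity ψ)))) ∧
      (rψ ≤ radiusOfConvexity ψ →
        (∀ r : ℝ, 0 < r → r < 1 → ψ (-(r : ℂ)) = (minModulus ψ r : ℂ)) →
        ∀ ρ : ℝ, min rψ (radiusOfConvexity ψ) < ρ → ρ ≤ 1 →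
          ∃ f : ℂ → ℂ, HarmonicClass ψ f ∧
            ¬ SensePreservingOn f (disk ρ) ∧ ¬ InjOn f (disk ρ)) := by
  refine ⟨existsUnique_isRadiusRoot hψ, fun r hr =>
    ⟨fun f hf => hf.sensePreservingOn_and_injOn hψ hr, fun hle hm ρ hρ hρ1 => ?_⟩⟩
  rw [min_eq_left hle] at hρ
  exact hr.exists_harmonicClass_not_injOn hψ hm hρ hρ1
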